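/- For $a,b\in\{0,1\}$ and positive integers $j,l$, where $j\ge 2$ or $a=1$, let $$L(j,l;a,b)=\sum_{m>n>0}\frac{(-1)^{am+bn}}{m^{j}n^{l}}=\lim_{M\to\infty}\ \sum_{M\ge m>n>0}\frac{(-1)^{am+bn}}{m^{j}n^{l}},$$ and write this alternating double zeta value as $\zeta(j,l)=L(j,l;0,0)$, $\zeta^{(2)}(j,\overline{l})=L(j,l;0,1)$, $\zeta^{(2)}(\overline{j},l)=L(j,l;1,0)$, $\zeta^{(2)}(\overline{j},\overline{l})=L(j,l;1,1)$. Let also $\zeta(k)=\sum_{m\ge1}m^{-k}$ and $\zeta^{(2)}(\overline{k})=\sum_{m\ge1}(-1)^m m^{-k}$. Then for every integer $k\ge 3$ all the series occurring below converge, and \begin{align*} &\sum_{j=2}^{k-1}\zeta(j,k-j)=\zeta(k),\\ &\sum_{j=2}^{k-1}\zeta^{(2)}(j,\overline{k-j})=\zeta^{(2)}(\overline{k-1},1)-\zeta^{(2)}(\overline{k-1},\overline{1})+\zeta^{(2)}(\overline{k}),\\ &\sum_{j=1}^{k-1}\zeta^{(2)}(\overline{j},\overline{k-j})=\zeta^{(2)}(\overline{1},k-1)+\zeta^{(2)}(\overline{k}),\\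 &\sum_{j=1}^{k-1}\zeta^{(2)}(\overline{j},k-j)=\zeta^{(2)}(\overline{k-1},\overline{1})-\zeta^{(2)}(\overline{k-1},1)+\zeta^{(2)}(\overline{1},\overline{k-1})+\zeta(k). \end{align*} -/

import Mathlib

open Filter Topology

noncomputable section

/-- The partial sum `∑_{M ≥ m > 0} (-1)^{a m} / m^k`. -/
def altZetaPartial (k : ℕ) (a : ZMod 2) (M : ℕ) : ℝ :=
  ∑ m ∈ Finset.Icc 1 M, (-1 : ℝ) ^ (a.val * m) / (m : ℝ) ^ k

/-- The alternating zeta value of depth one: `ζ^{(2)}(k)` for `a = 0` and `ζ^{(2)}(k̄)` for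
`a = 1`, that is `∑_{m > 0} (-1)^{a m} / m^k`, summed in increasing order of `m`. -/
def altZeta (k : ℕ) (a : ZMod 2) : ℝ :=
  limUnder atTop (altZetaPartial k a)

/-- The partial sum `∑_{M ≥ m > n > 0} (-1)^{a m + b n} / (m^k n^l)`. -/
def altDoubleZetaPartial (k l : ℕ) (a b : ZMod 2) (M : ℕ) : ℝ :=
  ∑ m ∈ Finset.Icc 1 M, ∑ n ∈ Finset.Ico 1 m,
    (-1 : ℝ) ^ (a.val * m + b.val * n) / ((m : ℝ) ^ k * (n : ℝ) ^ l)

/-- The alternating double zeta value `∑_{m > n > 0} (-1)^{a m + b n} / (m^k n^l)`, summed in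
increasing order of the outer index `m` (for `k = 1` the series converges only conditionally).
The first argument `k` is barred iff `a = 1`, the second argument `l` is barred iff `b = 1`. -/
def altDoubleZeta (k l : ℕ) (a b : ZMod 2) : ℝ :=
  limUnder atTop (altDoubleZetaPartial k l a b)

end

/-!
For `m > n > 0`, summing a geometric progression gives
`∑_{j=1}^{r} m^{-j} n^{-(r+1-j)} = (n^{-r} - m^{-r}) / (m - n)`. Multiply by `s^m t^n` with
`|s| ≤ 1`, `|t| = 1`, sum over `M ≥ m > n > 0` and put `d = m - n`. The second term becomes the
truncation of `Li_{r,1}(st, t⁻¹)`, the first one the sum of `(st)^n s^d / (n^r d)` over `n + d ≤ M`.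
For `r ≥ 2` the latter differs by `O(log M / M)` from the product of the truncations of `Li_r(st)`
and `Li_1(s)`, which the quasi-shuffle product expands as
`Li_{r,1}(st, s) + Li_{1,r}(s, st) + Li_{r+1}(s²t)`. Only the terms `Li_{1,r}` may diverge, namely
for `s = 1`, and then they cancel at every finite level. Signs `s, t = ±1` give the four formulas.
-/

section FiniteSums

open Finset

variable {A : Type*} [AddCommMonoid A]

theorem sum_Icc_one_eq_sum_range (f : ℕ → A) (M : ℕ) :
    ∑ m ∈ Icc 1 M, f m = ∑ i ∈ range M, f (i + 1) := by
  rw [range_eq_Ico, sum_Ico_add', zero_add, Ico_add_one_right_eq_Icc]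

theorem sum_Ico_one_reflect (f : ℕ → A) (m : ℕ) :
    ∑ n ∈ Ico 1 m, f (m - n) = ∑ n ∈ Ico 1 m, f n := by
  simpa using sum_Ico_reflect f 1 m.le_succ

theorem sum_Icc_sum_Icc_eq_triangles_add_diagonal (f : ℕ → ℕ → A) (M : ℕ) :
    ∑ m ∈ Icc 1 M, ∑ n ∈ Icc 1 M, f m n =
      ∑ m ∈ Icc 1 M, ∑ n ∈ Ico 1 m, f m n + ∑ m ∈ Icc 1 M, ∑ n ∈ Ico 1 m, f n m +
        ∑ m ∈ Icc 1 M, f m m := by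
  induction M with
  | zero => simp
  | succ M ih =>
    simp only [sum_Icc_succ_top (Nat.le_add_left 1 M), sum_add_distrib, ih,
      Ico_add_one_right_eq_Icc]
    abel

theorem sum_Icc_sum_Ico_sub (f : ℕ → ℕ → A) (M : ℕ) :
    ∑ m ∈ Icc 1 M, ∑ n ∈ Ico 1 m, f n (m - n) =
      ∑ n ∈ Icc 1 M, ∑ d ∈ Icc 1 (M - n), f n d := by
  have hswap : ∑ m ∈ Icc 1 M, ∑ n ∈ Ico 1 m, f n (m - n) =
      ∑ n ∈ Icc 1 M, ∑ m ∈ Ioc n M, f n (m - n) :=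
    sum_comm' fun m n => by simp only [mem_Icc, mem_Ico, mem_Ioc]; omega
  rw [hswap]
  refine sum_congr rfl fun n _ => sum_nbij' (· - n) (· + n) ?_ ?_ ?_ ?_ fun _ _ => rfl
  all_goals intro m hm; simp only [mem_Icc, mem_Ioc] at hm ⊢; omega

theorem sum_inv_pow_mul_inv_pow {K : Type*} [Field K] {x y : K} (hx : x ≠ 0) (hy : y ≠ 0)
    (hxy : x ≠ y) (r : ℕ) :
    ∑ j ∈ Icc 1 r, (x ^ j * y ^ (r + 1 - j))⁻¹ = ((y ^ r)⁻¹ - (x ^ r)⁻¹) / (x - y) := by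
  have hterm : ∀ i ∈ range r, (x ^ (i + 1) * y ^ (r + 1 - (i + 1)))⁻¹ =
      x⁻¹ * y⁻¹ * (x⁻¹ ^ i * y⁻¹ ^ (r - 1 - i)) := by
    intro i hi
    obtain ⟨e, rfl⟩ := Nat.exists_eq_add_of_lt (mem_range.1 hi)
    rw [show i + e + 1 + 1 - (i + 1) = e + 1 by omega, show i + e + 1 - 1 - i = e by omega]
    simp only [inv_pow, mul_inv, pow_succ]
    ring
  have hinv : x⁻¹ ≠ y⁻¹ := inv_injective.ne hxy
  rw [sum_Icc_one_eq_sum_range, sum_congr rfl hterm, ← mul_sum, geom₂_sum hinv, inv_sub_inv hx hy,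
    inv_pow, inv_pow]
  have hsub : x - y ≠ 0 := sub_ne_zero.2 hxy
  have hsub' : y - x ≠ 0 := sub_ne_zero.2 hxy.symm
  field_simp
  ring

end FiniteSums

section Truncations

open Finset

variable {K : Type*} [Field K]

/-- The truncation `∑_{M ≥ m > 0} s^m / m^k` of the polylogarithm `Li_k(s)`. -/
def polylogPartial (k : ℕ) (s : K) (M : ℕ) : K :=
  ∑ m ∈ Icc 1 M, s ^ m / (m : K) ^ k

/-- The truncation `∑_{M ≥ m > n > 0} s^m t^n / (m^j n^l)` of the double polylogarithm
`Li_{j,l}(s, t)`; as in the double zeta values, the first arguments belong to the larger index. -/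
def doublePolylogPartial (j l : ℕ) (s t : K) (M : ℕ) : K :=
  ∑ m ∈ Icc 1 M, ∑ n ∈ Ico 1 m, s ^ m * t ^ n / ((m : K) ^ j * (n : K) ^ l)

theorem polylogPartial_mul (k l : ℕ) (s t : K) (M : ℕ) :
    polylogPartial k s M * polylogPartial l t M =
      doublePolylogPartial k l s t M + doublePolylogPartial l k t s M +
        polylogPartial (k + l) (s * t) M := by
  simp only [polylogPartial, doublePolylogPartial, sum_mul_sum, div_mul_div_comm,
    sum_Icc_sum_Icc_eq_triangles_add_diagonal, mul_pow, pow_add, mul_comm]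

theorem sum_pow_mul_pow_div_outer_pow_mul_sub (r : ℕ) (s : K) {t : K} (ht : t ≠ 0) (M : ℕ) :
    ∑ m ∈ Icc 1 M, ∑ n ∈ Ico 1 m, s ^ m * t ^ n / ((m : K) ^ r * ((m : K) - n)) =
      doublePolylogPartial r 1 (s * t) t⁻¹ M := by
  refine sum_congr rfl fun m _ => ?_
  rw [← sum_Ico_one_reflect]
  refine sum_congr rfl fun n hn => ?_
  have hnm : n ≤ m := (mem_Ico.1 hn).2.le
  rw [Nat.cast_sub hnm, pow_one, mul_pow, inv_pow, mul_assoc, ← pow_sub₀ t ht (by omega),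
    sub_sub_cancel]

theorem sum_pow_mul_pow_div_inner_pow_mul_sub (r : ℕ) (s t : K) (M : ℕ) :
    ∑ m ∈ Icc 1 M, ∑ n ∈ Ico 1 m, s ^ m * t ^ n / ((n : K) ^ r * ((m : K) - n)) =
      ∑ n ∈ Icc 1 M, (s * t) ^ n / (n : K) ^ r * polylogPartial 1 s (M - n) := by
  simp only [polylogPartial, mul_sum]
  rw [← sum_Icc_sum_Ico_sub fun n d => (s * t) ^ n / (n : K) ^ r * (s ^ d / (d : K) ^ 1)]
  refine sum_congr rfl fun m _ => sum_congr rfl fun n hn => ?_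
  have hnm : n ≤ m := (mem_Ico.1 hn).2.le
  rw [Nat.cast_sub hnm, pow_one, div_mul_div_comm, mul_pow, mul_right_comm, ← pow_add,
    Nat.add_sub_cancel' hnm]

theorem sum_doublePolylogPartial [CharZero K] (r : ℕ) (s : K) {t : K} (ht : t ≠ 0) (M : ℕ) :
    ∑ j ∈ Icc 1 r, doublePolylogPartial j (r + 1 - j) s t M =
      ∑ n ∈ Icc 1 M, (s * t) ^ n / (n : K) ^ r * polylogPartial 1 s (M - n) -
        doublePolylogPartial r 1 (s * t) t⁻¹ M := by
  rw [← sum_pow_mul_pow_div_outer_pow_mul_sub r s ht, ← sum_pow_mul_pow_div_inner_pow_mul_sub,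
    ← sum_sub_distrib]
  simp only [doublePolylogPartial]
  rw [sum_comm]
  refine sum_congr rfl fun m hm => ?_
  rw [sum_comm, ← sum_sub_distrib]
  refine sum_congr rfl fun n hn => ?_
  have hn0 : (n : K) ≠ 0 := Nat.cast_ne_zero.2 (Nat.ne_of_gt (mem_Ico.1 hn).1)
  have hm0 : (m : K) ≠ 0 := Nat.cast_ne_zero.2 (Nat.ne_of_gt (mem_Icc.1 hm).1)
  have hmn : (m : K) ≠ n := Nat.cast_injective.ne (mem_Ico.1 hn).2.ne'
  simp only [div_eq_mul_inv (s ^ m * t ^ n), ← mul_sum, ← mul_sub]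
  rw [sum_inv_pow_mul_inv_pow hm0 hn0 hmn, mul_inv, mul_inv, ← sub_mul, div_eq_mul_inv]

end Truncations

section Convergence

variable {𝕜 : Type*} [RCLike 𝕜]

/-- The polylogarithm `Li_k(s)`, summed in increasing order of the index because for `k = 1` and
`|s| = 1` the series converges only conditionally; junk where the series diverges. -/
noncomputable def polylog (k : ℕ) (s : 𝕜) : 𝕜 :=
  limUnder atTop (polylogPartial k s)

/-- The double polylogarithm `Li_{j,l}(s, t)`, summed in increasing order of the outer index;
junk where the series diverges. -/
noncomputable def doublePolylog (j l : ℕ) (s t : 𝕜) : 𝕜 :=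
  limUnder atTop (doublePolylogPartial j l s t)

theorem tendsto_sum_Icc_one_of_summable {A : Type*} [AddCommGroup A] [TopologicalSpace A]
    [IsTopologicalAddGroup A] {f : ℕ → A} (hf : Summable f) :
    Tendsto (fun M => ∑ m ∈ Finset.Icc 1 M, f m) atTop (𝓝 (∑' i, f (i + 1))) := by
  simp only [sum_Icc_one_eq_sum_range]
  exact ((summable_nat_add_iff 1).2 hf).hasSum.tendsto_sum_nat

theorem norm_pow_div_natCast_pow_le {s : 𝕜} (hs : ‖s‖ ≤ 1) (k m : ℕ) :
    ‖s ^ m / (m : 𝕜) ^ k‖ ≤ 1 / (m : ℝ) ^ k := by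
  rw [norm_div, norm_pow, norm_pow, RCLike.norm_natCast]
  gcongr
  exact pow_le_one₀ (norm_nonneg s) hs

theorem tendsto_polylogPartial_tsum {k : ℕ} (hk : 2 ≤ k) {s : 𝕜} (hs : ‖s‖ ≤ 1) :
    Tendsto (polylogPartial k s) atTop (𝓝 (∑' i : ℕ, s ^ (i + 1) / ((i + 1 : ℕ) : 𝕜) ^ k)) :=
  tendsto_sum_Icc_one_of_summable <| .of_norm_bounded
    (Real.summable_one_div_nat_pow.2 hk) (norm_pow_div_natCast_pow_le hs k)

theorem norm_sum_range_pow_succ_le {s : 𝕜} (hs : ‖s‖ ≤ 1) (hs1 : s ≠ 1) (N : ℕ) :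
    ‖∑ i ∈ Finset.range N, s ^ (i + 1)‖ ≤ 2 / ‖s - 1‖ := by
  have hpow (n : ℕ) : ‖s ^ n‖ ≤ 1 := by
    rw [norm_pow]
    exact pow_le_one₀ (norm_nonneg s) hs
  simp only [pow_succ, ← Finset.sum_mul]
  rw [geom_sum_eq hs1, norm_mul, norm_div]
  calc ‖s ^ N - 1‖ / ‖s - 1‖ * ‖s‖ ≤ ‖s ^ N - 1‖ / ‖s - 1‖ :=
        mul_le_of_le_one_right (by positivity) hs
    _ ≤ 2 / ‖s - 1‖ := by
      gcongr
      linarith [norm_sub_le (s ^ N) 1, hpow N, norm_one (α := 𝕜)]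

theorem exists_tendsto_polylogPartial_of_ne_one {k : ℕ} (hk : 1 ≤ k) {s : 𝕜} (hs : ‖s‖ ≤ 1)
    (hs1 : s ≠ 1) : ∃ L, Tendsto (polylogPartial k s) atTop (𝓝 L) := by
  have hanti : Antitone fun i : ℕ => 1 / ((i : ℝ) + 1) ^ k := fun i j hij => by
    dsimp only
    gcongr
  have hzero : Tendsto (fun i : ℕ => 1 / ((i : ℝ) + 1) ^ k) atTop (𝓝 0) := by
    simpa [Nat.ne_of_gt hk] using (tendsto_one_div_add_atTop_nhds_zero_nat (𝕜 := ℝ)).pow k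
  obtain ⟨L, hL⟩ := cauchySeq_tendsto_of_complete <|
    hanti.cauchySeq_series_mul_of_tendsto_zero_of_bounded hzero
      (norm_sum_range_pow_succ_le hs hs1)
  refine ⟨L, hL.congr fun M => ?_⟩
  rw [polylogPartial, sum_Icc_one_eq_sum_range]
  refine Finset.sum_congr rfl fun i _ => ?_
  rw [RCLike.real_smul_eq_coe_mul]
  push_cast
  ring

theorem tendsto_polylogPartial {k : ℕ} (hk : 1 ≤ k) {s : 𝕜} (hs : ‖s‖ ≤ 1)
    (h : 2 ≤ k ∨ s ≠ 1) : Tendsto (polylogPartial k s) atTop (𝓝 (polylog k s)) :=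
  tendsto_nhds_limUnder <| h.elim (fun hk2 => ⟨_, tendsto_polylogPartial_tsum hk2 hs⟩)
    (exists_tendsto_polylogPartial_of_ne_one hk hs)

theorem ofReal_polylog_one_eq_riemannZeta {k : ℕ} (hk : 2 ≤ k) :
    ((polylog k (1 : ℝ) : ℝ) : ℂ) = riemannZeta k := by
  have hshift := (Real.summable_one_div_nat_pow.2 hk).tsum_eq_zero_add
  rw [Nat.cast_zero, zero_pow (by omega), div_zero, zero_add] at hshift
  rw [polylog, (tendsto_polylogPartial_tsum hk norm_one.le).limUnder_eq,
    zeta_nat_eq_tsum_of_gt_one hk]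
  simp only [one_pow]
  rw [← hshift, Complex.ofReal_tsum]
  push_cast
  rfl

/-- Splitting the total exponent `2 + 1` evenly dominates a double series over `m > n` by a product
of two convergent series. -/
theorem rpow_three_halves_mul_rpow_three_halves_le {x y : ℝ} (hy : 1 ≤ y) (hyx : y ≤ x)
    {j l : ℕ} (hj : 2 ≤ j) (hl : 1 ≤ l) :
    x ^ (3 / 2 : ℝ) * y ^ (3 / 2 : ℝ) ≤ x ^ j * y ^ l := by
  have hy0 : 0 < y := by linarith
  have hx0 : 0 < x := by linarith
  calc x ^ (3 / 2 : ℝ) * y ^ (3 / 2 : ℝ) = x ^ (3 / 2 : ℝ) * (y ^ (1 / 2 : ℝ) * y) := by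
        rw [← Real.rpow_add_one hy0.ne']
        norm_num
    _ ≤ x ^ (3 / 2 : ℝ) * (x ^ (1 / 2 : ℝ) * y) := by gcongr
    _ = x ^ 2 * y := by
        rw [← mul_assoc, ← Real.rpow_add hx0]
        norm_num
    _ ≤ x ^ j * y ^ l := by
        gcongr
        · exact hy.trans hyx
        · exact le_self_pow₀ hy (by omega)

theorem norm_sum_Ico_doublePolylog_le {j l : ℕ} (hj : 2 ≤ j) (hl : 1 ≤ l) {s t : 𝕜}
    (hs : ‖s‖ ≤ 1) (ht : ‖t‖ ≤ 1) (m : ℕ) :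
    ‖∑ n ∈ Finset.Ico 1 m, s ^ m * t ^ n / ((m : 𝕜) ^ j * (n : 𝕜) ^ l)‖ ≤
      ((m : ℝ) ^ (3 / 2 : ℝ))⁻¹ * ∑' n : ℕ, ((n : ℝ) ^ (3 / 2 : ℝ))⁻¹ := by
  have hsummable : Summable fun n : ℕ => ((n : ℝ) ^ (3 / 2 : ℝ))⁻¹ :=
    Real.summable_nat_rpow_inv.2 (by norm_num)
  have hterm : ∀ n ∈ Finset.Ico 1 m, ‖s ^ m * t ^ n / ((m : 𝕜) ^ j * (n : 𝕜) ^ l)‖ ≤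
      ((m : ℝ) ^ (3 / 2 : ℝ))⁻¹ * ((n : ℝ) ^ (3 / 2 : ℝ))⁻¹ := by
    intro n hn
    obtain ⟨hn1, hnm⟩ := Finset.mem_Ico.1 hn
    have hn0 : (0 : ℝ) < n := by exact_mod_cast hn1
    have hm0 : (0 : ℝ) < m := hn0.trans (by exact_mod_cast hnm)
    have hrpow := rpow_three_halves_mul_rpow_three_halves_le (x := m) (y := n)
      (by exact_mod_cast hn1) (by exact_mod_cast hnm.le) hj hl
    rw [← div_mul_div_comm, norm_mul]
    calc ‖s ^ m / (m : 𝕜) ^ j‖ * ‖t ^ n / (n : 𝕜) ^ l‖ ≤ 1 / (m : ℝ) ^ j * (1 / (n : ℝ) ^ l) := by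
          gcongr
          · exact norm_pow_div_natCast_pow_le hs j m
          · exact norm_pow_div_natCast_pow_le ht l n
      _ = ((m : ℝ) ^ j * (n : ℝ) ^ l)⁻¹ := by rw [one_div, one_div, mul_inv]
      _ ≤ ((m : ℝ) ^ (3 / 2 : ℝ) * (n : ℝ) ^ (3 / 2 : ℝ))⁻¹ := by
          gcongr
      _ = _ := mul_inv _ _
  refine (norm_sum_le_of_le _ hterm).trans ?_
  rw [← Finset.mul_sum]
  gcongr
  exact hsummable.sum_le_tsum _ fun n _ => by positivity

theorem exists_tendsto_doublePolylogPartial_of_two_le {j l : ℕ} (hj : 2 ≤ j) (hl : 1 ≤ l)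
    {s t : 𝕜} (hs : ‖s‖ ≤ 1) (ht : ‖t‖ ≤ 1) :
    ∃ L, Tendsto (doublePolylogPartial j l s t) atTop (𝓝 L) :=
  ⟨_, tendsto_sum_Icc_one_of_summable <| .of_norm_bounded
    ((Real.summable_nat_rpow_inv.2 (by norm_num)).mul_right _)
    (norm_sum_Ico_doublePolylog_le hj hl hs ht)⟩

theorem exists_tendsto_doublePolylogPartial_one {l : ℕ} (hl : 2 ≤ l) {s t : 𝕜} (hs : ‖s‖ ≤ 1)
    (hs1 : s ≠ 1) (ht : ‖t‖ ≤ 1) :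
    ∃ L, Tendsto (doublePolylogPartial 1 l s t) atTop (𝓝 L) := by
  obtain ⟨D, hD⟩ := exists_tendsto_doublePolylogPartial_of_two_le hl le_rfl ht hs
  have hst : ‖s * t‖ ≤ 1 := (norm_mul_le s t).trans (mul_le_one₀ hs (norm_nonneg t) ht)
  have hprod := (tendsto_polylogPartial le_rfl hs (.inr hs1)).mul
    (tendsto_polylogPartial (by omega) ht (.inl hl))
  have hdiag := tendsto_polylogPartial (k := 1 + l) (by omega) hst (.inl (by omega))
  refine ⟨_, ((hprod.sub hD).sub hdiag).congr fun M => ?_⟩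
  linear_combination polylogPartial_mul 1 l s t M

theorem tendsto_doublePolylogPartial {j l : ℕ} (hj : 1 ≤ j) (hl : 1 ≤ l) (hjl : 3 ≤ j + l)
    {s t : 𝕜} (hs : ‖s‖ ≤ 1) (ht : ‖t‖ ≤ 1) (h : 2 ≤ j ∨ s ≠ 1) :
    Tendsto (doublePolylogPartial j l s t) atTop (𝓝 (doublePolylog j l s t)) := by
  refine tendsto_nhds_limUnder ?_
  rcases hj.eq_or_lt with rfl | hj2
  · exact exists_tendsto_doublePolylogPartial_one (by omega) hs (h.resolve_left (by omega)) ht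
  · exact exists_tendsto_doublePolylogPartial_of_two_le hj2 hl hs ht

end Convergence

section CauchyProduct

open Finset

variable {𝕜 : Type*} [RCLike 𝕜]

theorem norm_polylogPartial_one_sub_le {s : 𝕜} (hs : ‖s‖ ≤ 1) {M n : ℕ} (hn : n ≤ M) :
    ‖polylogPartial 1 s M - polylogPartial 1 s (M - n)‖ ≤ n / ((M : ℝ) + 1 - n) := by
  have hnM : (n : ℝ) ≤ M := by exact_mod_cast hn
  have hsplit : polylogPartial 1 s M - polylogPartial 1 s (M - n) =
      ∑ m ∈ Ioc (M - n) M, s ^ m / (m : 𝕜) ^ 1 :=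
    sub_eq_of_eq_add' (sum_Ioc_consecutive _ (Nat.zero_le _) (Nat.sub_le M n)).symm
  have hterm : ∀ m ∈ Ioc (M - n) M, ‖s ^ m / (m : 𝕜) ^ 1‖ ≤ 1 / ((M : ℝ) + 1 - n) := by
    intro m hm
    have hMm : (M : ℝ) + 1 ≤ m + n := by
      have := (mem_Ioc.1 hm).1
      exact_mod_cast (by omega : M + 1 ≤ m + n)
    refine (norm_pow_div_natCast_pow_le hs 1 m).trans ?_
    rw [pow_one]
    exact one_div_le_one_div_of_le (by linarith) (by linarith)
  rw [hsplit]
  calc ‖∑ m ∈ Ioc (M - n) M, s ^ m / (m : 𝕜) ^ 1‖ ≤ ∑ _m ∈ Ioc (M - n) M, 1 / ((M : ℝ) + 1 - n) :=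
        norm_sum_le_of_le _ hterm
    _ = n / ((M : ℝ) + 1 - n) := by
        rw [sum_const, Nat.card_Ioc, Nat.sub_sub_self hn, nsmul_eq_mul, mul_one_div]

theorem sum_Icc_inv_add_inv_reflect (M : ℕ) :
    ∑ n ∈ Icc 1 M, ((n : ℝ)⁻¹ + ((M : ℝ) + 1 - n)⁻¹) = 2 * ∑ n ∈ Icc 1 M, (n : ℝ)⁻¹ := by
  have hreflect : ∑ n ∈ Icc 1 M, ((M : ℝ) + 1 - n)⁻¹ = ∑ n ∈ Icc 1 M, (n : ℝ)⁻¹ := by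
    rw [← Ico_add_one_right_eq_Icc, ← sum_Ico_one_reflect fun n : ℕ => (n : ℝ)⁻¹]
    refine sum_congr rfl fun n hn => ?_
    rw [Nat.cast_sub (mem_Ico.1 hn).2.le, Nat.cast_add, Nat.cast_one]
  rw [sum_add_distrib, hreflect, two_mul]

theorem norm_polylogPartial_mul_sub_le {r : ℕ} (hr : 2 ≤ r) {s u : 𝕜} (hs : ‖s‖ ≤ 1)
    (hu : ‖u‖ ≤ 1) (M : ℕ) :
    ‖polylogPartial r u M * polylogPartial 1 s M -
        ∑ n ∈ Icc 1 M, u ^ n / (n : 𝕜) ^ r * polylogPartial 1 s (M - n)‖ ≤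
      2 * (((M : ℝ) + 1)⁻¹ * ∑ n ∈ Icc 1 M, (n : ℝ)⁻¹) := by
  have hterm : ∀ n ∈ Icc 1 M,
      ‖u ^ n / (n : 𝕜) ^ r * (polylogPartial 1 s M - polylogPartial 1 s (M - n))‖ ≤
        ((M : ℝ) + 1)⁻¹ * ((n : ℝ)⁻¹ + ((M : ℝ) + 1 - n)⁻¹) := by
    intro n hn
    obtain ⟨hn1, hnM⟩ := mem_Icc.1 hn
    have hn1' : (1 : ℝ) ≤ n := by exact_mod_cast hn1
    have hpos : 0 < (M : ℝ) + 1 - n := by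
      have : (n : ℝ) ≤ M := by exact_mod_cast hnM
      linarith
    have hpow : 1 / (n : ℝ) ^ r ≤ 1 / (n : ℝ) ^ 2 := by gcongr
    rw [norm_mul]
    calc _ ≤ 1 / (n : ℝ) ^ 2 * (n / ((M : ℝ) + 1 - n)) := by
          gcongr
          · exact (norm_pow_div_natCast_pow_le hu r n).trans hpow
          · exact norm_polylogPartial_one_sub_le hs hnM
      _ = ((M : ℝ) + 1)⁻¹ * ((n : ℝ)⁻¹ + ((M : ℝ) + 1 - n)⁻¹) := by
          field_simp
          ring
  calc _ = ‖∑ n ∈ Icc 1 M,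
        u ^ n / (n : 𝕜) ^ r * (polylogPartial 1 s M - polylogPartial 1 s (M - n))‖ := by
        simp only [mul_sub, sum_sub_distrib, ← sum_mul]
        rfl
    _ ≤ ∑ n ∈ Icc 1 M, ((M : ℝ) + 1)⁻¹ * ((n : ℝ)⁻¹ + ((M : ℝ) + 1 - n)⁻¹) :=
        norm_sum_le_of_le _ hterm
    _ = _ := by rw [← mul_sum, sum_Icc_inv_add_inv_reflect, mul_left_comm]

theorem tendsto_inv_mul_sum_Icc_inv :
    Tendsto (fun M : ℕ => ((M : ℝ) + 1)⁻¹ * ∑ n ∈ Icc 1 M, (n : ℝ)⁻¹) atTop (𝓝 0) := by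
  have hcesaro := (tendsto_inv_atTop_nhds_zero_nat (𝕜 := ℝ)).cesaro
  refine ((tendsto_add_atTop_iff_nat 1).2 hcesaro).congr fun M => ?_
  rw [sum_range_succ', sum_Icc_one_eq_sum_range]
  simp

theorem tendsto_polylogPartial_mul_sub {r : ℕ} (hr : 2 ≤ r) {s u : 𝕜} (hs : ‖s‖ ≤ 1)
    (hu : ‖u‖ ≤ 1) :
    Tendsto (fun M => polylogPartial r u M * polylogPartial 1 s M -
      ∑ n ∈ Icc 1 M, u ^ n / (n : 𝕜) ^ r * polylogPartial 1 s (M - n)) atTop (𝓝 0) :=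
  squeeze_zero_norm (norm_polylogPartial_mul_sub_le hr hs hu) <| by
    simpa only [mul_zero] using tendsto_inv_mul_sum_Icc_inv.const_mul 2

end CauchyProduct

section SumFormula

open Finset

variable {𝕜 : Type*} [RCLike 𝕜] {s t : 𝕜}

theorem tendsto_sum_doublePolylogPartial_sub {r : ℕ} (hr : 2 ≤ r) (hs : ‖s‖ ≤ 1) (ht : ‖t‖ = 1) :
    Tendsto (fun M => ∑ j ∈ Icc 1 r, doublePolylogPartial j (r + 1 - j) s t M -
        doublePolylogPartial 1 r s (s * t) M) atTop
      (𝓝 (doublePolylog r 1 (s * t) s - doublePolylog r 1 (s * t) t⁻¹ +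
        polylog (r + 1) (s ^ 2 * t))) := by
  have ht0 : t ≠ 0 := norm_ne_zero_iff.1 (ht ▸ one_ne_zero)
  have hst : ‖s * t‖ ≤ 1 := by rwa [norm_mul, ht, mul_one]
  have hsst : ‖s ^ 2 * t‖ ≤ 1 := by
    rw [norm_mul, ht, mul_one, norm_pow]
    exact pow_le_one₀ (norm_nonneg s) hs
  have htinv : ‖t⁻¹‖ ≤ 1 := by rw [norm_inv, ht, inv_one]
  have hshuffle := tendsto_doublePolylogPartial (by omega) le_rfl (by omega) hst hs (.inl hr)
  have hreflect := tendsto_doublePolylogPartial (by omega) le_rfl (by omega) hst htinv (.inl hr)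
  have hdiag := tendsto_polylogPartial (k := r + 1) (by omega) hsst (.inl (by omega))
  have hlim := ((hshuffle.sub hreflect).add hdiag).sub (tendsto_polylogPartial_mul_sub hr hs hst)
  rw [sub_zero] at hlim
  refine hlim.congr fun M => ?_
  have hmul := polylogPartial_mul r 1 (s * t) s M
  rw [show s * t * s = s ^ 2 * t by ring] at hmul
  linear_combination -hmul - sum_doublePolylogPartial r s ht0 M

theorem sum_doublePolylog_one {r : ℕ} (hr : 2 ≤ r) (ht : ‖t‖ = 1) :
    ∑ j ∈ Icc 2 r, doublePolylog j (r + 1 - j) 1 t =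
      doublePolylog r 1 t 1 - doublePolylog r 1 t t⁻¹ + polylog (r + 1) t := by
  have hsum : Tendsto (fun M => ∑ j ∈ Icc 2 r, doublePolylogPartial j (r + 1 - j) 1 t M) atTop
      (𝓝 (∑ j ∈ Icc 2 r, doublePolylog j (r + 1 - j) 1 t)) := by
    refine tendsto_finsetSum _ fun j hj => ?_
    obtain ⟨hj2, hjr⟩ := mem_Icc.1 hj
    exact tendsto_doublePolylogPartial (by omega) (by omega) (by omega) norm_one.le ht.le (.inl hj2)
  have hlim := tendsto_sum_doublePolylogPartial_sub hr norm_one.le ht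
  simp only [one_mul, one_pow] at hlim
  refine tendsto_nhds_unique hsum (hlim.congr fun M => ?_)
  rw [← add_sum_Ioc_eq_sum_Icc (by omega : 1 ≤ r), Nat.add_sub_cancel, add_sub_cancel_left,
    ← Icc_add_one_left_eq_Ioc, one_add_one_eq_two]

theorem sum_doublePolylog {r : ℕ} (hr : 2 ≤ r) (hs : ‖s‖ ≤ 1) (hs1 : s ≠ 1) (ht : ‖t‖ = 1) :
    ∑ j ∈ Icc 1 r, doublePolylog j (r + 1 - j) s t =
      doublePolylog r 1 (s * t) s - doublePolylog r 1 (s * t) t⁻¹ +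
        doublePolylog 1 r s (s * t) + polylog (r + 1) (s ^ 2 * t) := by
  have hsum : Tendsto (fun M => ∑ j ∈ Icc 1 r, doublePolylogPartial j (r + 1 - j) s t M) atTop
      (𝓝 (∑ j ∈ Icc 1 r, doublePolylog j (r + 1 - j) s t)) := by
    refine tendsto_finsetSum _ fun j hj => ?_
    obtain ⟨hj1, hjr⟩ := mem_Icc.1 hj
    exact tendsto_doublePolylogPartial hj1 (by omega) (by omega) hs ht.le (.inr hs1)
  have hst : ‖s * t‖ ≤ 1 := by rwa [norm_mul, ht, mul_one]
  have hone := tendsto_doublePolylogPartial le_rfl (by omega) (by omega : 3 ≤ 1 + r) hs hst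
    (.inr hs1)
  have hlim := tendsto_nhds_unique (hsum.sub hone) (tendsto_sum_doublePolylogPartial_sub hr hs ht)
  linear_combination hlim

theorem mainTheorem6_general {k : ℕ} (hk : 3 ≤ k) :
    (∀ s : 𝕜, ‖s‖ ≤ 1 → Tendsto (polylogPartial k s) atTop (𝓝 (polylog k s))) ∧
    (∀ j ∈ Icc 1 (k - 1), ∀ s t : 𝕜, ‖s‖ ≤ 1 → ‖t‖ ≤ 1 → (2 ≤ j ∨ s ≠ 1) →
      Tendsto (doublePolylogPartial j (k - j) s t) atTop (𝓝 (doublePolylog j (k - j) s t))) ∧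
    (∀ t : 𝕜, ‖t‖ = 1 → ∑ j ∈ Icc 2 (k - 1), doublePolylog j (k - j) 1 t =
      doublePolylog (k - 1) 1 t 1 - doublePolylog (k - 1) 1 t t⁻¹ + polylog k t) ∧
    ∀ s t : 𝕜, ‖s‖ ≤ 1 → s ≠ 1 → ‖t‖ = 1 → ∑ j ∈ Icc 1 (k - 1), doublePolylog j (k - j) s t =
      doublePolylog (k - 1) 1 (s * t) s - doublePolylog (k - 1) 1 (s * t) t⁻¹ +
        doublePolylog 1 (k - 1) s (s * t) + polylog k (s ^ 2 * t) := by
  obtain ⟨r, rfl⟩ : ∃ r, k = r + 1 := ⟨k - 1, by omega⟩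
  have hr : 2 ≤ r := by omega
  refine ⟨fun s hs => tendsto_polylogPartial (by omega) hs (.inl (by omega)),
    fun j hj s t hs ht h => ?_, fun t => sum_doublePolylog_one hr,
    fun s t => sum_doublePolylog hr⟩
  obtain ⟨hj1, hjr⟩ := mem_Icc.1 hj
  exact tendsto_doublePolylogPartial hj1 (by omega) (by omega) hs ht h

end SumFormula

theorem altZetaPartial_eq_polylogPartial (k : ℕ) (a : ZMod 2) :
    altZetaPartial k a = polylogPartial k ((-1 : ℝ) ^ a.val) := by
  funext M
  simp only [altZetaPartial, polylogPartial, pow_mul]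

theorem altDoubleZetaPartial_eq_doublePolylogPartial (j l : ℕ) (a b : ZMod 2) :
    altDoubleZetaPartial j l a b =
      doublePolylogPartial j l ((-1 : ℝ) ^ a.val) ((-1 : ℝ) ^ b.val) := by
  funext M
  simp only [altDoubleZetaPartial, doublePolylogPartial, pow_add, pow_mul]

theorem altZeta_eq_polylog (k : ℕ) (a : ZMod 2) :
    altZeta k a = polylog k ((-1 : ℝ) ^ a.val) := by
  rw [altZeta, altZetaPartial_eq_polylogPartial, polylog]

theorem altDoubleZeta_eq_doublePolylog (j l : ℕ) (a b : ZMod 2) :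
    altDoubleZeta j l a b = doublePolylog j l ((-1 : ℝ) ^ a.val) ((-1 : ℝ) ^ b.val) := by
  rw [altDoubleZeta, altDoubleZetaPartial_eq_doublePolylogPartial, doublePolylog]

theorem mainTheorem6 (k : ℕ) (hk : 3 ≤ k) :
    -- the series defining the values of weight `k` converge
    (∀ a : ZMod 2, Tendsto (altZetaPartial k a) atTop (𝓝 (altZeta k a))) ∧
    (∀ j ∈ Finset.Icc 1 (k - 1), ∀ a b : ZMod 2, (2 ≤ j ∨ a = 1) →
      Tendsto (altDoubleZetaPartial j (k - j) a b) atTop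
        (𝓝 (altDoubleZeta j (k - j) a b))) ∧
    -- the four sum formulas
    ((∑ j ∈ Finset.Icc 2 (k - 1), altDoubleZeta j (k - j) 0 0 : ℝ) : ℂ) = riemannZeta k ∧
    ∑ j ∈ Finset.Icc 2 (k - 1), altDoubleZeta j (k - j) 0 1 =
      altDoubleZeta (k - 1) 1 1 0 - altDoubleZeta (k - 1) 1 1 1 + altZeta k 1 ∧
    ∑ j ∈ Finset.Icc 1 (k - 1), altDoubleZeta j (k - j) 1 1 =
      altDoubleZeta 1 (k - 1) 1 0 + altZeta k 1 ∧
    ((∑ j ∈ Finset.Icc 1 (k - 1), altDoubleZeta j (k - j) 1 0 : ℝ) : ℂ) =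
      ((altDoubleZeta (k - 1) 1 1 1 - altDoubleZeta (k - 1) 1 1 0
        + altDoubleZeta 1 (k - 1) 1 1 : ℝ) : ℂ) + riemannZeta k := by
  obtain ⟨hzeta, hdouble, hone, hne⟩ := mainTheorem6_general (𝕜 := ℝ) hk
  have hnorm (a : ZMod 2) : ‖(-1 : ℝ) ^ a.val‖ = 1 := by simp
  have hsign : (-1 : ℝ) ^ (1 : ZMod 2).val ≠ 1 := by norm_num [ZMod.val_one]
  simp only [altZeta_eq_polylog, altDoubleZeta_eq_doublePolylog,
    altZetaPartial_eq_polylogPartial, altDoubleZetaPartial_eq_doublePolylogPartial]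
  refine ⟨fun a => hzeta _ (hnorm a).le, fun j hj a b h => hdouble j hj _ _ (hnorm a).le
    (hnorm b).le (h.imp_right (by rintro rfl; exact hsign)), ?_⟩
  simp only [ZMod.val_zero, ZMod.val_one, pow_zero, pow_one]
  rw [← ofReal_polylog_one_eq_riemannZeta (by omega), ← Complex.ofReal_add]
  norm_cast
  refine ⟨?_, ?_, ?_, ?_⟩
  · simpa using hone 1 (by simp)
  · simpa using hone (-1) (by simp)
  · simpa using hne (-1) (-1) (by simp) (by norm_num) (by simp)
  · simpa using hne (-1) 1 (by simp) (by norm_num) (by simp)
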